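/- Let $G$ be an abelian group, written additively. For $A,B\subseteq G$ write $A-B=\{a-b : a\in A,\ b\in B\}$. A subset $C\subseteq G$ is *solid* if it is not properly contained in any set $D\subseteq G$ with $D-D=C-C$. For $W\subseteq G$, the set $C$ is a *supplement* for $W$ if the translates $c+W$ $(c\in C)$ are pairwise disjoint, and a *maximal supplement* for $W$ if moreover no proper superset of $C$ in $G$ is a supplement for $W$. The set $C$ is a *maximal supplement in $G$* if it is a maximal supplement for some $W\subseteq G$. **Theorem.** There is an absolute constant $b>0$ such that the following holds. Let $G$ be a finite abelian group and let $C\subseteq G$ be a non-empty solid subset. If $$|C|\le b\left(\frac{|G|}{\log|G|}\right)^{1/4},$$ then $C$ is a maximal supplement in $G$. (For $|G|=1$, where $\log|G|=0$, the right-hand side is read as $+\infty$, so that the condition holds.) -/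

import Mathlib

open scoped Pointwise

/-- `C` is solid: it is not properly contained in any set `D` with `D - D = C - C`. -/
def IsSolid {G : Type*} [AddCommGroup G] (C : Set G) : Prop :=
  ¬ ∃ D : Set G, C ⊂ D ∧ D - D = C - C

/-- `C` is an (additive) supplement for `W`: the translates `c + W`, for `c ∈ C`, are
pairwise disjoint. -/
def IsSupplementFor {G : Type*} [AddCommGroup G] (C W : Set G) : Prop :=
  C.PairwiseDisjoint fun c => c +ᵥ W

/-- `C` is a maximal supplement for `W`: it is a supplement for `W`, and no proper superset of `C`
is a supplement for `W`. -/
def IsMaximalSupplementFor {G : Type*} [AddCommGroup G] (C W : Set G) : Prop :=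
  IsSupplementFor C W ∧ ∀ C' : Set G, C ⊂ C' → ¬ IsSupplementFor C' W

/-- `C` is a maximal supplement in `G`: it is a maximal supplement for some subset `W` of `G`. -/
def IsMaximalSupplement {G : Type*} [AddCommGroup G] (C : Set G) : Prop :=
  ∃ W : Set G, IsMaximalSupplementFor C W

/-! Put S = C - C, a symmetric set containing 0 with at most |C|² elements. If W - W meets S only in
0 and contains Sᶜ, then C is a maximal supplement for W: the first property makes the translates
disjoint, and solidity gives, for each d ∉ C, some c ∈ C with d - c ∉ S, so that d + W meets c + W
(`IsSolid.isMaximalSupplementFor`).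

Such a W exists when |S| is a small multiple of √(N / log N), N = |G| (`exists_difference_set`);
hence the exponent 1/4. It is a derandomised random choice of 2k elements, k ≈ 3√(N log N), each
outside W + S. In the second half, a random choice covers a given t with probability at least
k/(2N), provided t has at most k/2 conflicts, which an exponential moment guarantees. At most 2N
exp(-k²/(2N)) < 1 elements then stay uncovered. `exists_greedy` controls both quantities by one
potential. -/

/-- The number of pairs `(x, y)` in `W × W` for which `x + t` lies in `y + S`. -/
def conflictCount {G : Type*} [AddCommGroup G] [DecidableEq G] (S W : Finset G) (t : G) : ℕ :=
  ∑ x ∈ W, ∑ y ∈ W, if x + t - y ∈ S then 1 else 0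

/-- The elements outside `S` that are not differences of two elements of `W`. -/
def uncovered {G : Type*} [AddCommGroup G] [Fintype G] [DecidableEq G] (S W : Finset G) :
    Finset G :=
  {t ∈ Sᶜ | ∀ x ∈ W, ∀ y ∈ W, x - y ≠ t}

/-- The elements that lie in no translate `w + S` with `w ∈ W`. -/
def admissible {G : Type*} [AddCommGroup G] [Fintype G] [DecidableEq G] (S W : Finset G) :
    Finset G :=
  {a | ∀ w ∈ W, a - w ∉ S}

/-- The exponential moment of the conflict counts of the elements outside `S`. -/
noncomputable def conflictEnergy {G : Type*} [AddCommGroup G] [Fintype G] [DecidableEq G]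
    (l : ℝ) (S W : Finset G) : ℝ :=
  ∑ t ∈ Sᶜ, Real.exp (l * conflictCount S W t)

/-! ### Average effect of adding one admissible element -/

section Greedy

variable {G : Type*} [AddCommGroup G] [DecidableEq G]

/-- The pair `(a, a)` adds nothing, because `t ∉ S`. -/
lemma conflictCount_insert {S W : Finset G} {a t : G} (ha : a ∉ W) (ht : t ∉ S) :
    conflictCount S (insert a W) t = conflictCount S W t +
      ((∑ y ∈ W, if a + t - y ∈ S then 1 else 0) + ∑ x ∈ W, if x + t - a ∈ S then 1 else 0) := by
  simp only [conflictCount, Finset.sum_insert ha, Finset.sum_add_distrib]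
  simp [ht]
  ring

lemma sum_ite_sub_mem_le_card (S W : Finset G) (c : G) :
    (∑ y ∈ W, if c - y ∈ S then 1 else 0) ≤ S.card := by
  rw [← Finset.card_filter]
  refine Finset.card_le_card_of_injOn (fun y => c - y) (fun y hy => ?_) ?_
  · simpa using (Finset.mem_filter.1 hy).2
  · intro x _ y _ h
    simpa using h

lemma sum_ite_add_mem_le_card (S W : Finset G) (c : G) :
    (∑ y ∈ W, if y + c ∈ S then 1 else 0) ≤ S.card := by
  rw [← Finset.card_filter]
  refine Finset.card_le_card_of_injOn (fun y => y + c) (fun y hy => ?_) ?_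
  · simpa using (Finset.mem_filter.1 hy).2
  · intro x _ y _ h
    simpa using h

variable [Fintype G]

lemma not_mem_of_mem_admissible {S W : Finset G} (h0 : (0 : G) ∈ S) {a : G}
    (ha : a ∈ admissible S W) : a ∉ W := by
  intro h
  have := (Finset.mem_filter.1 ha).2 a h
  simp [h0] at this

lemma card_sub_le_card_admissible (S W : Finset G) :
    Fintype.card G ≤ (admissible S W).card + W.card * S.card := by
  have h : (admissible S W)ᶜ ⊆ (W ×ˢ S).image (fun p => p.1 + p.2) := by
    intro a ha
    simp only [admissible, Finset.mem_compl, Finset.mem_filter, Finset.mem_univ, true_and,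
      not_forall, not_not] at ha
    obtain ⟨w, hw, hs⟩ := ha
    exact Finset.mem_image.2 ⟨(w, a - w), by simp [hw, hs], by simp⟩
  have h1 := (Finset.card_le_card h).trans Finset.card_image_le
  rw [Finset.card_product] at h1
  have h2 := Finset.card_add_card_compl (admissible S W)
  omega

lemma sum_univ_ite_add_mem (S : Finset G) (c : G) :
    (∑ a : G, if a + c ∈ S then 1 else 0) = S.card := by
  rw [Fintype.sum_equiv (Equiv.addRight c) (fun a => if a + c ∈ S then 1 else 0)
    (fun a => if a ∈ S then 1 else 0) (fun _ => rfl)]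
  simp

lemma sum_univ_ite_sub_mem (S : Finset G) (c : G) :
    (∑ a : G, if c - a ∈ S then 1 else 0) = S.card := by
  rw [Fintype.sum_equiv (Equiv.subLeft c) (fun a => if c - a ∈ S then 1 else 0)
    (fun a => if a ∈ S then 1 else 0) (fun _ => rfl)]
  simp

lemma sum_univ_conflict_increment (S W : Finset G) (t : G) :
    ∑ a : G, ((∑ y ∈ W, if a + t - y ∈ S then 1 else 0) +
      ∑ x ∈ W, if x + t - a ∈ S then 1 else 0) = 2 * (W.card * S.card) := by
  rw [Finset.sum_add_distrib, Finset.sum_comm, Finset.sum_comm (s := Finset.univ) (t := W)]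
  simp only [add_sub_assoc, sum_univ_ite_add_mem]
  simp only [← add_sub_assoc, sum_univ_ite_sub_mem, Finset.sum_const, smul_eq_mul]
  ring

lemma exp_le_one_add_two_mul {x : ℝ} (h0 : 0 ≤ x) (h1 : x ≤ 1) : Real.exp x ≤ 1 + 2 * x := by
  have h := Real.abs_exp_sub_one_le (x := x) (by rwa [abs_of_nonneg h0])
  rw [abs_of_nonneg h0] at h
  linarith [le_abs_self (Real.exp x - 1)]

lemma conflictEnergy_nonneg (l : ℝ) (S W : Finset G) : 0 ≤ conflictEnergy l S W :=
  Finset.sum_nonneg fun _ _ => (Real.exp_pos _).le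

/-- For fixed `t` the increments are at most `2 * S.card`, so `l` times them lies in [0, 1], where
exp x ≤ 1 + 2x; over all `a` they sum to `2 * (W.card * S.card)`. -/
lemma sum_conflictEnergy_insert_le {l : ℝ} (hl : 0 ≤ l) {S W : Finset G} (h0 : (0 : G) ∈ S)
    (hlS : 2 * l * S.card ≤ 1) :
    ∑ a ∈ admissible S W, conflictEnergy l S (insert a W) ≤
      ((admissible S W).card + 4 * l * W.card * S.card) * conflictEnergy l S W := by
  simp only [conflictEnergy]
  rw [Finset.sum_comm, Finset.mul_sum]
  refine Finset.sum_le_sum fun t ht => ?_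
  have ht' : t ∉ S := Finset.mem_compl.1 ht
  set Y : G → ℕ := fun a => (∑ y ∈ W, if a + t - y ∈ S then 1 else 0) +
      ∑ x ∈ W, if x + t - a ∈ S then 1 else 0 with hY
  have hYle : ∀ a, Y a ≤ 2 * S.card := by
    intro a
    have h1 := sum_ite_sub_mem_le_card S W (a + t)
    have h2 := sum_ite_add_mem_le_card S W (t - a)
    simp only [← add_sub_assoc] at h2
    simp only [hY]
    omega
  have hYsum : ∑ a ∈ admissible S W, (Y a : ℝ) ≤ 2 * (W.card * S.card) := by
    have h1 : ∑ a ∈ admissible S W, Y a ≤ ∑ a, Y a :=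
      Finset.sum_le_sum_of_subset (Finset.subset_univ _)
    rw [show ∑ a, Y a = _ from sum_univ_conflict_increment S W t] at h1
    exact_mod_cast h1
  calc ∑ a ∈ admissible S W, Real.exp (l * conflictCount S (insert a W) t)
      ≤ ∑ a ∈ admissible S W, (1 + 2 * (l * Y a)) * Real.exp (l * conflictCount S W t) := by
        refine Finset.sum_le_sum fun a ha => ?_
        rw [conflictCount_insert (not_mem_of_mem_admissible h0 ha) ht', Nat.cast_add, mul_add,
          Real.exp_add, mul_comm]
        refine mul_le_mul_of_nonneg_right ?_ (Real.exp_pos _).le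
        have h1 : (Y a : ℝ) ≤ 2 * S.card := by exact_mod_cast hYle a
        exact exp_le_one_add_two_mul (by positivity) (by nlinarith)
    _ = ((admissible S W).card + 2 * l * ∑ a ∈ admissible S W, (Y a : ℝ)) *
          Real.exp (l * conflictCount S W t) := by
        rw [← Finset.sum_mul, Finset.sum_add_distrib, Finset.mul_sum]
        simp [mul_assoc]
    _ ≤ _ := by
        refine mul_le_mul_of_nonneg_right ?_ (Real.exp_pos _).le
        nlinarith

lemma uncovered_insert_subset (S W : Finset G) (a : G) :
    uncovered S (insert a W) ⊆ uncovered S W := by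
  intro t ht
  simp only [uncovered, Finset.mem_filter] at ht ⊢
  exact ⟨ht.1, fun x hx y hy => ht.2 x (Finset.mem_insert_of_mem hx) y
    (Finset.mem_insert_of_mem hy)⟩

/-- If `w + t` is admissible, adding it covers `t` as `(w + t) - w`; if not, `w` is the first entry
of a conflicting pair. -/
lemma card_le_card_covering_add_conflictCount (S W : Finset G) (t : G) :
    W.card ≤ ({a ∈ admissible S W | t ∉ uncovered S (insert a W)}).card +
      conflictCount S W t := by
  have h1 : ({w ∈ W | w + t ∈ admissible S W}).card ≤
      ({a ∈ admissible S W | t ∉ uncovered S (insert a W)}).card := by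
    refine Finset.card_le_card_of_injOn (fun w => w + t) (fun w hw => ?_) ?_
    · obtain ⟨hw, hwt⟩ := Finset.mem_filter.1 hw
      refine Finset.mem_coe.2 (Finset.mem_filter.2 ⟨hwt, fun h => ?_⟩)
      exact (Finset.mem_filter.1 h).2 (w + t) (Finset.mem_insert_self _ _) w
        (Finset.mem_insert_of_mem hw) (by simp)
    · intro x _ y _ h
      simpa using h
  have h2 : ({w ∈ W | w + t ∉ admissible S W}).card ≤ conflictCount S W t := by
    rw [Finset.card_filter]
    refine Finset.sum_le_sum fun x hx => ?_
    by_cases h : x + t ∈ admissible S W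
    · simp [h]
    · rw [if_pos h]
      simp only [admissible, Finset.mem_filter, Finset.mem_univ, true_and, not_forall,
        not_not] at h
      obtain ⟨y, hy, hs⟩ := h
      refine le_trans ?_ (Finset.single_le_sum (fun _ _ => Nat.zero_le _) hy)
      simp [hs]
  have h3 := Finset.card_filter_add_card_filter_not (s := W) (fun w => w + t ∈ admissible S W)
  omega

lemma sum_card_uncovered_insert_le {S W : Finset G} {θ : ℝ}
    (hθ : ∀ t ∉ S, (conflictCount S W t : ℝ) ≤ θ) :
    ∑ a ∈ admissible S W, ((uncovered S (insert a W)).card : ℝ) ≤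
      ((admissible S W).card - (W.card - θ)) * (uncovered S W).card := by
  have h1 : ∀ a, ((uncovered S (insert a W)).card : ℝ) =
      ∑ t ∈ uncovered S W, if t ∈ uncovered S (insert a W) then 1 else 0 := by
    intro a
    rw [Finset.sum_boole]
    congr 2
    ext t
    simp only [Finset.mem_filter]
    exact ⟨fun h => ⟨uncovered_insert_subset S W a h, h⟩, fun h => h.2⟩
  simp only [h1]
  rw [Finset.sum_comm, mul_comm, ← nsmul_eq_mul, ← Finset.sum_const]
  refine Finset.sum_le_sum fun t ht => ?_
  rw [Finset.sum_boole]
  have htS : t ∉ S := Finset.mem_compl.1 (Finset.mem_filter.1 ht).1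
  have h2 := card_le_card_covering_add_conflictCount S W t
  have h3 := Finset.card_filter_add_card_filter_not (s := admissible S W)
    (fun a => t ∈ uncovered S (insert a W))
  have h4 := hθ t htS
  have h2' : (W.card : ℝ) ≤ ({a ∈ admissible S W | t ∉ uncovered S (insert a W)}).card +
      conflictCount S W t := by exact_mod_cast h2
  have h3' : (({a ∈ admissible S W | t ∈ uncovered S (insert a W)}).card : ℝ) +
      ({a ∈ admissible S W | t ∉ uncovered S (insert a W)}).card = (admissible S W).card := by
    exact_mod_cast h3
  linarith

/-- One greedy step: some admissible element can be added to `W` so that a weighted potential,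
combining the number of uncovered elements and the conflict energy, behaves as on average. -/
lemma exists_admissible_potential_le {l : ℝ} (hl : 0 ≤ l) {S W : Finset G} (h0 : (0 : G) ∈ S)
    (hlS : 2 * l * S.card ≤ 1) {q r α β : ℝ} (hα : 0 ≤ α) (hβ : 0 ≤ β)
    (hWS : 2 * (W.card * S.card : ℝ) ≤ Fintype.card G)
    (hr : 1 + 8 * l * W.card * S.card / Fintype.card G ≤ r)
    (hq : 1 ≤ q ∨ ∃ θ : ℝ, θ ≤ W.card ∧ (∀ t ∉ S, (conflictCount S W t : ℝ) ≤ θ) ∧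
      1 - (W.card - θ) / Fintype.card G ≤ q) :
    ∃ a ∈ admissible S W,
      α * (uncovered S (insert a W)).card + β * conflictEnergy l S (insert a W) ≤
        α * (q * (uncovered S W).card) + β * (r * conflictEnergy l S W) := by
  have hN : (0 : ℝ) < Fintype.card G := by exact_mod_cast Fintype.card_pos_iff.2 ⟨(0 : G)⟩
  have hF : (Fintype.card G : ℝ) ≤ (admissible S W).card + W.card * S.card := by
    exact_mod_cast card_sub_le_card_admissible S W
  have hFN : ((admissible S W).card : ℝ) ≤ Fintype.card G := by
    exact_mod_cast Finset.card_le_univ _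
  have hFpos : (0 : ℝ) < (admissible S W).card := by linarith
  have hne : (admissible S W).Nonempty := Finset.card_pos.1 (by exact_mod_cast hFpos)
  have hU : ∑ a ∈ admissible S W, ((uncovered S (insert a W)).card : ℝ) ≤
      (admissible S W).card * (q * (uncovered S W).card) := by
    rcases hq with hq | ⟨θ, hθW, hθ, hq⟩
    · rw [← nsmul_eq_mul, ← Finset.sum_const]
      refine Finset.sum_le_sum fun a _ => ?_
      have : ((uncovered S (insert a W)).card : ℝ) ≤ (uncovered S W).card := by
        exact_mod_cast Finset.card_le_card (uncovered_insert_subset S W a)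
      nlinarith [Nat.cast_nonneg (α := ℝ) (uncovered S W).card]
    · refine (sum_card_uncovered_insert_le hθ).trans ?_
      rw [← mul_assoc]
      refine mul_le_mul_of_nonneg_right ?_ (Nat.cast_nonneg _)
      have h1 : (admissible S W).card * ((W.card - θ) / Fintype.card G) ≤ W.card - θ := by
        rw [mul_div_assoc', div_le_iff₀ hN, mul_comm]
        exact mul_le_mul_of_nonneg_left hFN (by linarith)
      nlinarith
  have hE : ∑ a ∈ admissible S W, conflictEnergy l S (insert a W) ≤
      (admissible S W).card * (r * conflictEnergy l S W) := by
    refine (sum_conflictEnergy_insert_le hl h0 hlS).trans ?_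
    rw [← mul_assoc]
    refine mul_le_mul_of_nonneg_right ?_ (conflictEnergy_nonneg l S W)
    -- By `hWS` at least half of the group is admissible, whence 8 in place of 4.
    have h1 : 4 * l * W.card * S.card ≤
        (admissible S W).card * (8 * l * W.card * S.card / Fintype.card G) := by
      rw [mul_div_assoc', le_div_iff₀ hN]
      have : (0 : ℝ) ≤ 4 * l * W.card * S.card := by positivity
      nlinarith
    nlinarith
  refine Finset.exists_le_of_sum_le hne ?_
  rw [Finset.sum_add_distrib, ← Finset.mul_sum, ← Finset.mul_sum, Finset.sum_const, nsmul_eq_mul]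
  have h1 := mul_le_mul_of_nonneg_left hU hα
  have h2 := mul_le_mul_of_nonneg_left hE hβ
  linarith

lemma conflictCount_le_of_exp_le {l M : ℝ} (hl : 0 < l) {S W : Finset G} {t : G} (ht : t ∉ S)
    (h : conflictEnergy l S W ≤ Real.exp (l * M)) : (conflictCount S W t : ℝ) ≤ M := by
  have h1 : Real.exp (l * conflictCount S W t) ≤ conflictEnergy l S W :=
    Finset.single_le_sum (f := fun t => Real.exp (l * conflictCount S W t))
      (fun _ _ => (Real.exp_pos _).le) (Finset.mem_compl.2 ht)
  exact le_of_mul_le_mul_left (Real.exp_le_exp.1 (h1.trans h)) hl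

/-! ### Iterating the greedy step and choosing parameters -/

/-- The greedy construction run for `i ≤ 2 k` steps. -/
lemma exists_greedy {S : Finset G} (h0 : (0 : G) ∈ S) (hneg : ∀ x ∈ S, -x ∈ S) {k : ℕ}
    {l r : ℝ} (hl : 0 < l) (hlS : 2 * l * S.card ≤ 1)
    (hkS : 4 * (k * S.card : ℝ) ≤ Fintype.card G)
    (hr : 1 + 16 * l * k * S.card / Fintype.card G ≤ r)
    (hM : 2 * Fintype.card G * r ^ (2 * k) ≤ Real.exp (l * (k / 2))) (i : ℕ) (hi : i ≤ 2 * k) :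
    ∃ W : Finset G, W.card = i ∧ (∀ x ∈ W, ∀ y ∈ W, x - y ∈ S → x = y) ∧
      (((1 - k / (2 * Fintype.card G) : ℝ) ^ (i - k))⁻¹ * (uncovered S W).card +
        (r ^ i)⁻¹ * conflictEnergy l S W ≤ 2 * Fintype.card G) := by
  have hN : (0 : ℝ) < Fintype.card G := by exact_mod_cast Fintype.card_pos_iff.2 ⟨(0 : G)⟩
  have hS : (1 : ℝ) ≤ S.card := by exact_mod_cast Finset.card_pos.2 ⟨0, h0⟩
  have hk0 : (0 : ℝ) ≤ k := Nat.cast_nonneg k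
  have hr1 : 1 ≤ r := le_trans (le_add_of_nonneg_right (by positivity)) hr
  have hq0 : (0 : ℝ) < 1 - k / (2 * Fintype.card G) := by
    rw [sub_pos, div_lt_one (by positivity)]
    nlinarith
  induction i with
  | zero =>
    refine ⟨∅, rfl, by simp, ?_⟩
    have h1 : ((uncovered S ∅).card : ℝ) ≤ Fintype.card G := by
      exact_mod_cast Finset.card_le_univ _
    have h2 : conflictEnergy l S ∅ ≤ Fintype.card G := by
      simp only [conflictEnergy, conflictCount, Finset.sum_empty, Nat.cast_zero, mul_zero,
        Real.exp_zero, Finset.sum_const, nsmul_eq_mul, mul_one]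
      exact_mod_cast Finset.card_le_univ _
    simp only [Nat.zero_sub, pow_zero, inv_one, one_mul]
    linarith
  | succ i ih =>
    obtain ⟨W, hWi, hW, hpot⟩ := ih (by omega)
    set Q : ℝ := 1 - k / (2 * Fintype.card G) with hQ
    have hi' : (i : ℝ) ≤ 2 * k := by exact_mod_cast (by omega : i ≤ 2 * k)
    -- Truncated subtraction freezes the weight of the uncovered count during the first `k` steps;
    -- each later step gains a factor `Q`.
    obtain ⟨a, ha, hle⟩ := exists_admissible_potential_le (W := W) hl.le h0 hlS
      (q := if i < k then 1 else Q) (r := r) (α := (Q ^ (i + 1 - k))⁻¹) (β := (r ^ (i + 1))⁻¹)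
      (by positivity) (by positivity) (by rw [hWi]; nlinarith)
      (by
        refine le_trans ?_ hr
        rw [hWi]
        gcongr 1 + ?_ / _
        have : 0 ≤ l * S.card := by positivity
        nlinarith)
      (by
        split_ifs with h
        · exact Or.inl le_rfl
        · right
          have hki : (k : ℝ) ≤ i := by exact_mod_cast not_lt.1 h
          -- The potential bounds the energy, so `hM` caps every conflict count by `k / 2`, at most
          -- half of the current size of `W`.
          refine ⟨k / 2, by rw [hWi]; linarith, fun t ht => ?_, ?_⟩
          · refine conflictCount_le_of_exp_le hl ht (le_trans ?_ hM)
            have h1 : (r ^ i)⁻¹ * conflictEnergy l S W ≤ 2 * Fintype.card G := by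
              refine le_trans (le_add_of_nonneg_left ?_) hpot
              positivity
            rw [inv_mul_le_iff₀ (by positivity), mul_comm] at h1
            refine h1.trans ?_
            gcongr
            omega
          · rw [hWi, hQ]
            have : (k : ℝ) / (2 * Fintype.card G) ≤ (i - k / 2) / Fintype.card G := by
              rw [← div_div]
              gcongr
              linarith
            linarith)
    refine ⟨insert a W, ?_, ?_, ?_⟩
    · rw [Finset.card_insert_of_notMem (not_mem_of_mem_admissible h0 ha), hWi]
    · have ha' : ∀ w ∈ W, a - w ∉ S := (Finset.mem_filter.1 ha).2
      intro x hx y hy hxy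
      rcases Finset.mem_insert.1 hx with rfl | hx <;>
        rcases Finset.mem_insert.1 hy with rfl | hy
      · rfl
      · exact absurd hxy (ha' y hy)
      · exact absurd (by simpa using hneg _ hxy) (ha' x ‹x ∈ W›)
      · exact hW x hx y hy hxy
    · refine hle.trans (le_trans (le_of_eq ?_) hpot)
      congr 1
      · rw [← mul_assoc]
        congr 1
        split_ifs with h
        · rw [Nat.sub_eq_zero_of_le (by omega : i + 1 ≤ k), Nat.sub_eq_zero_of_le h.le]
          simp
        · rw [Nat.sub_add_comm (not_lt.1 h), pow_succ]
          field_simp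
      · rw [← mul_assoc, pow_succ]
        congr 1
        field_simp

/-- If `S` is symmetric and small, then some `W` has difference set exactly `Sᶜ ∪ {0}`. -/
lemma exists_difference_set {S : Finset G} (h0 : (0 : G) ∈ S) (hneg : ∀ x ∈ S, -x ∈ S)
    (hcard : 2 ≤ Fintype.card G)
    (hS : (S.card : ℝ) ≤ 1 / 400 * √(Fintype.card G / Real.log (Fintype.card G))) :
    ∃ W : Finset G, (∀ x ∈ W, ∀ y ∈ W, x - y ∈ S → x = y) ∧
      ∀ t ∉ S, ∃ x ∈ W, ∃ y ∈ W, x - y = t := by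
  set N : ℝ := (Fintype.card G : ℝ) with hNdef
  set L := Real.log N with hL
  have hN2 : (2 : ℝ) ≤ N := by
    rw [hNdef]
    exact_mod_cast hcard
  have hN : 0 < N := by linarith
  have hL0 : 1 / 2 < L := by
    have h1 : Real.log 2 ≤ L := Real.log_le_log (by norm_num) hN2
    linarith [Real.log_two_gt_d9]
  have hLpos : 0 < L := by linarith
  have hexpL : Real.exp L = N := Real.exp_log hN
  set A := √(N * L) with hA
  have hAsq : A ^ 2 = N * L := Real.sq_sqrt (by positivity)
  have hA1 : 1 ≤ A := Real.one_le_sqrt.2 (by nlinarith)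
  set B := √(N / L) with hB
  have hBsq : B ^ 2 = N / L := Real.sq_sqrt (by positivity)
  have hB0 : 0 < B := Real.sqrt_pos.2 (by positivity)
  have hAB : A = L * B := by
    rw [hA, hB, show N * L = L ^ 2 * (N / L) by field_simp, Real.sqrt_mul (by positivity),
      Real.sqrt_sq hLpos.le]
  have hABN : A * B = N := by
    rw [hAB, mul_assoc, ← pow_two, hBsq]
    field_simp
  -- The factor 3 gives k²/(2N) ≥ 9L/2, which beats 2N ≤ exp(2L).
  set k := ⌈3 * A⌉₊ with hk
  have hk1 : 3 * A ≤ k := Nat.le_ceil _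
  have hk2 : (k : ℝ) ≤ 4 * A := by
    have := Nat.ceil_lt_add_one (show 0 ≤ 3 * A by positivity)
    linarith
  have hs1 : (1 : ℝ) ≤ S.card := by exact_mod_cast Finset.card_pos.2 ⟨0, h0⟩
  have hks : (k : ℝ) * S.card ≤ 4 * A * (1 / 400 * B) :=
    mul_le_mul hk2 hS (by positivity) (by positivity)
  have hk4 : 4 * ((k : ℝ) * S.card) ≤ N := by nlinarith
  have hkk : (k : ℝ) ^ 2 ≤ 16 * (N * L) := by nlinarith
  have hkk' : 9 * (N * L) ≤ (k : ℝ) ^ 2 := by nlinarith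
  -- `l` is the largest value with `2 * l * S.card ≤ 1`; `r` is then forced up to 1 + 8k/N.
  obtain ⟨W, -, hW, hpot⟩ := exists_greedy (k := k) (l := 1 / (2 * S.card)) (r := 1 + 8 * k / N)
    h0 hneg (by positivity) (le_of_eq (by field_simp)) hk4
    (le_of_eq (by rw [← hNdef]; field_simp; ring))
    (by
      rw [← hNdef]
      have h1 : (1 + 8 * k / N) ^ (2 * k) ≤ Real.exp (256 * L) := by
        calc (1 + 8 * k / N) ^ (2 * k) ≤ Real.exp (8 * k / N) ^ (2 * k) := by
              gcongr
              linarith [Real.add_one_le_exp (8 * k / N)]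
          _ = Real.exp (16 * (k ^ 2 / N)) := by
              rw [← Real.exp_nat_mul]
              congr 1
              push_cast
              ring
          _ ≤ _ := by
              rw [Real.exp_le_exp]
              have : (k : ℝ) ^ 2 / N ≤ 16 * L := by
                rw [div_le_iff₀ hN]
                linarith
              linarith
      calc 2 * N * (1 + 8 * k / N) ^ (2 * k) ≤ N * N * Real.exp (256 * L) := by gcongr
        _ = Real.exp (258 * L) := by
            rw [← hexpL, ← Real.exp_add, ← Real.exp_add]
            congr 1
            ring
        _ ≤ _ := by
            rw [Real.exp_le_exp, one_div_mul_eq_div, le_div_iff₀ (by positivity)]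
            -- The exponent is k/(4|S|) ≥ 300L, from k ≥ 3A = 3LB and |S| ≤ B/400.
            have : L * (S.card : ℝ) ≤ L * (1 / 400 * B) := by gcongr
            nlinarith)
    (2 * k) le_rfl
  refine ⟨W, hW, fun t ht => ?_⟩
  rw [← hNdef, show 2 * k - k = k by omega] at hpot
  have hq0 : (0 : ℝ) < 1 - k / (2 * N) := by
    rw [sub_pos, div_lt_one (by positivity)]
    nlinarith
  have hU : ((uncovered S W).card : ℝ) < 1 := by
    have h1 : ((1 - k / (2 * N) : ℝ) ^ k)⁻¹ * (uncovered S W).card ≤ 2 * N := by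
      refine le_trans (le_add_of_nonneg_right ?_) hpot
      exact mul_nonneg (by positivity) (conflictEnergy_nonneg _ _ _)
    rw [inv_mul_le_iff₀ (by positivity)] at h1
    have h2 : (1 - k / (2 * N) : ℝ) ^ k ≤ Real.exp (-(9 / 2 * L)) := by
      calc (1 - k / (2 * N) : ℝ) ^ k ≤ Real.exp (-(k / (2 * N))) ^ k := by
            gcongr
            exact Real.one_sub_le_exp_neg _
        _ = Real.exp (-(k ^ 2 / (2 * N))) := by
            rw [← Real.exp_nat_mul]
            congr 1
            ring
        _ ≤ _ := by
            rw [Real.exp_le_exp, neg_le_neg_iff, le_div_iff₀ (by positivity)]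
            linarith
    calc ((uncovered S W).card : ℝ) ≤ (1 - k / (2 * N) : ℝ) ^ k * (2 * N) := h1
      _ ≤ Real.exp (-(9 / 2 * L)) * (N * N) := by gcongr
      _ = Real.exp (-(5 / 2 * L)) := by
          rw [← hexpL, ← Real.exp_add, ← Real.exp_add]
          congr 1
          ring
      _ < 1 := by
          rw [Real.exp_lt_one_iff]
          linarith
  have hempty : uncovered S W = ∅ := Finset.card_eq_zero.1 (by
    have : (uncovered S W).card < 1 := by exact_mod_cast hU
    omega)
  by_contra! hcon
  have : t ∈ uncovered S W := Finset.mem_filter.2 ⟨Finset.mem_compl.2 ht, hcon⟩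
  simp [hempty] at this

end Greedy

/-! ### Solid sets and maximal supplements -/

/-- Otherwise adjoining `d` to `C` would leave the difference set unchanged. -/
lemma IsSolid.exists_sub_notMem {G : Type*} [AddCommGroup G] {C : Set G} (hC : IsSolid C)
    (hne : C.Nonempty) {d : G} (hd : d ∉ C) : ∃ c ∈ C, d - c ∉ C - C := by
  by_contra! hcon
  refine hC ⟨insert d C, Set.ssubset_insert hd, Set.Subset.antisymm ?_ ?_⟩
  · rintro _ ⟨x, hx, y, hy, rfl⟩
    rcases hx with rfl | hx <;> rcases hy with rfl | hy
    · obtain ⟨c, hc⟩ := hne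
      exact ⟨c, hc, c, hc, by simp⟩
    · exact hcon y hy
    · obtain ⟨u, hu, v, hv, huv⟩ := hcon x hx
      exact ⟨v, hv, u, hu, by simp only at huv ⊢; rw [← neg_sub, huv, neg_sub]⟩
    · exact ⟨x, hx, y, hy, rfl⟩
  · exact Set.sub_subset_sub (Set.subset_insert _ _) (Set.subset_insert _ _)

lemma IsSolid.isMaximalSupplementFor {G : Type*} [AddCommGroup G] {C W : Set G}
    (hC : IsSolid C) (hne : C.Nonempty) (hW : ∀ x ∈ W, ∀ y ∈ W, x - y ∈ C - C → x = y)
    (hcov : ∀ t ∉ C - C, ∃ x ∈ W, ∃ y ∈ W, x - y = t) : IsMaximalSupplementFor C W := by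
  refine ⟨fun c hc d hd hcd => ?_, fun C' hCC' hsup => ?_⟩
  · rw [Function.onFun, Set.disjoint_left]
    rintro _ ⟨x, hx, rfl⟩ ⟨y, hy, hxy⟩
    simp only [vadd_eq_add] at hxy
    have h1 : y - x = c - d := by
      rw [sub_eq_sub_iff_add_eq_add, add_comm y, hxy]
    have h2 := hW y hy x hx (h1 ▸ Set.sub_mem_sub hc hd)
    subst h2
    exact hcd (add_right_cancel hxy).symm
  · obtain ⟨d, hd, hdC⟩ := Set.exists_of_ssubset hCC'
    obtain ⟨c, hc, hdc⟩ := hC.exists_sub_notMem hne hdC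
    obtain ⟨x, hx, y, hy, hxy⟩ := hcov _ hdc
    have hne' : d ≠ c := fun h => hdC (h ▸ hc)
    refine Set.disjoint_left.1 (hsup hd (hCC'.subset hc) hne') ⟨y, hy, rfl⟩ ⟨x, hx, ?_⟩
    rw [sub_eq_sub_iff_add_eq_add] at hxy
    simp only [vadd_eq_add]
    rw [add_comm c, hxy]

theorem theorem1p4 :
    ∃ b : ℝ, 0 < b ∧
      ∀ (G : Type*) [AddCommGroup G] [Finite G] (C : Set G),
        C.Nonempty → IsSolid C →
        (Nat.card G = 1 ∨
          (C.ncard : ℝ) ≤ b * ((Nat.card G : ℝ) / Real.log (Nat.card G : ℝ)) ^ (1 / 4 : ℝ)) →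
        IsMaximalSupplement C := by
  refine ⟨1 / 20, by norm_num, fun G _ _ C hne hC h => ?_⟩
  classical
  have := Fintype.ofFinite G
  rcases Nat.lt_or_ge (Nat.card G) 2 with h1 | h2
  · have : Subsingleton G := (Finite.card_le_one_iff_subsingleton).1 (by omega)
    -- In a trivial group the non-empty `C` is everything and has no proper superset.
    refine ⟨Set.univ, fun c _ d _ hcd => absurd (Subsingleton.elim c d) hcd, fun C' hCC' => ?_⟩
    obtain ⟨d, -, hd⟩ := Set.exists_of_ssubset hCC'
    obtain ⟨c, hc⟩ := hne
    exact absurd (Subsingleton.elim c d ▸ hc) hd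
  · have hle := h.resolve_left (by omega)
    rw [Nat.card_eq_fintype_card] at h2 hle
    have hN2 : (2 : ℝ) ≤ Fintype.card G := by exact_mod_cast h2
    set R : ℝ := (Fintype.card G : ℝ) / Real.log (Fintype.card G : ℝ) with hR
    have hR0 : 0 ≤ R := div_nonneg (by linarith) (Real.log_nonneg (by linarith))
    have hcoe : ((C.toFinset - C.toFinset : Finset G) : Set G) = C - C := by simp
    have hmem : ∀ x, x ∈ C.toFinset - C.toFinset ↔ x ∈ C - C := fun x => by
      rw [← hcoe, Finset.mem_coe]
    -- The constant 1/400 is the square of b = 1/20, since |C - C| ≤ |C|².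
    have hcard : ((C.toFinset - C.toFinset).card : ℝ) ≤ 1 / 400 * √R := by
      have h3 : ((C.toFinset - C.toFinset).card : ℝ) ≤ (C.ncard : ℝ) ^ 2 := by
        rw [Set.ncard_eq_toFinset_card', pow_two]
        exact_mod_cast Finset.card_sub_le
      have h4 : √R = (R ^ (1 / 4 : ℝ)) ^ 2 := by
        rw [Real.sqrt_eq_rpow, ← Real.rpow_mul_natCast hR0]
        norm_num
      rw [h4]
      have h5 : (C.ncard : ℝ) ^ 2 ≤ (1 / 20 * R ^ (1 / 4 : ℝ)) ^ 2 := by gcongr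
      linarith [h5, mul_pow (1 / 20 : ℝ) (R ^ (1 / 4 : ℝ)) 2]
    obtain ⟨W, hW, hcov⟩ := exists_difference_set (S := C.toFinset - C.toFinset)
      (by obtain ⟨c, hc⟩ := hne
          exact (hmem 0).2 ⟨c, hc, c, hc, by simp⟩)
      (fun x hx => by
        obtain ⟨u, hu, v, hv, rfl⟩ := (hmem x).1 hx
        exact (hmem _).2 ⟨v, hv, u, hu, by simp⟩)
      h2 hcard
    refine ⟨W, hC.isMaximalSupplementFor hne (fun x hx y hy hxy => ?_) (fun t ht => ?_)⟩
    · exact hW x hx y hy ((hmem _).2 hxy)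
    · exact hcov t (fun h => ht ((hmem t).1 h))
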